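/- Let $S$ be a finite set of cardinality $d$ with an involution $s\mapsto\overline s$ (fixed points are allowed), and let $S^*$ be the free monoid of words over $S$. A language is a set $L\subseteq S^*$. A language $M$ is *saturated* if $uv\in M\Leftrightarrow us\overline sv\in M$ for all $u,v\in S^*$ and $s\in S$; it is *desiccated* if no word of $M$ contains a factor of the form $s\overline s$. For a language $L$ let $\langle L\rangle$ be its saturation, the smallest saturated language containing $L$, and let $\widehat L$ be its desiccation, the largest desiccated language contained in $L$. Let $\Sigma=\langle S\mid s\overline s=1\ \forall s\in S\rangle$ (a monoid presentation), let $\phi:S^*\to\Sigma$ be the canonical projection, and define the growth series $$\Theta(L)(t)=\sum_{w\in L}\phi(w)\,t^{|w|}\in\mathbb Z[\Sigma][[t]].$$ Then for every language $L$ $$\frac{\Theta(\widehat{\langle L\rangle})(t)}{1-t^2}=\frac{\Theta(\langle L\rangle)\left(\frac{t}{1+(d-1)t^2}\right)}{1+(d-1)t^2}.$$ Moreover, the identity $$\frac{\Theta(\widehat{L})(t)}{1-t^2}=\frac{\Theta(\langle L\rangle)\left(\frac{t}{1+(d-1)t^2}\right)}{1+(d-1)t^2}$$ holds if and only if $\widehat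 L=\widehat{\langle L\rangle}$, that is, if and only if every desiccated word of $\langle L\rangle$ already lies in $L$; in particular it holds whenever $L$ is saturated. -/

import Mathlib

namespace WordGrowth

open PowerSeries

variable {S : Type*}

/-- `L` is stable under insertion and deletion of factors `s s̄`. -/
def IsSaturated (bar : S → S) (L : Language S) : Prop :=
  ∀ (u v : List S) (s : S), u ++ v ∈ L ↔ u ++ [s, bar s] ++ v ∈ L

/-- No word of `L` contains a factor `s s̄`. -/
def IsDesiccated (bar : S → S) (L : Language S) : Prop :=
  ∀ w ∈ L, ∀ s : S, ¬ [s, bar s] <:+: w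

/-- The smallest saturated language containing `L`. -/
def saturation (bar : S → S) (L : Language S) : Language S :=
  sInf {M | IsSaturated bar M ∧ L ≤ M}

/-- The largest desiccated language contained in `L`. -/
def desiccation (bar : S → S) (L : Language S) : Language S :=
  sSup {M | IsDesiccated bar M ∧ M ≤ L}

theorem isLeast_saturation (bar : S → S) (L : Language S) :
    IsLeast {M | IsSaturated bar M ∧ L ≤ M} (saturation bar L) := by
  refine ⟨⟨fun u v s => ?_, le_sInf fun M hM => hM.2⟩, fun M hM => sInf_le hM⟩
  constructor
  · rintro h M hM
    exact (hM.1 u v s).1 (h M hM)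
  · rintro h M hM
    exact (hM.1 u v s).2 (h M hM)

theorem isGreatest_desiccation (bar : S → S) (L : Language S) :
    IsGreatest {M | IsDesiccated bar M ∧ M ≤ L} (desiccation bar L) := by
  refine ⟨⟨fun w hw => ?_, sSup_le fun M hM => hM.2⟩, fun M hM => le_sSup hM⟩
  obtain ⟨M, hM, hwM⟩ := hw
  exact hM.1 w hwM

/-- The relations `s s̄ = 1`, for `s` in `S`. -/
inductive CancelRel (bar : S → S) : FreeMonoid S → FreeMonoid S → Prop
  | cancel (s : S) : CancelRel bar (FreeMonoid.of s * FreeMonoid.of (bar s)) 1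

/-- The monoid `Σ = ⟨S | s s̄ = 1 for all s⟩`. -/
abbrev Sig (bar : S → S) : Type _ := PresentedMonoid (CancelRel bar)

/-- The canonical projection `φ` from words to `Σ`. -/
def proj (bar : S → S) (w : List S) : Sig bar :=
  PresentedMonoid.mk (CancelRel bar) (FreeMonoid.ofList w)

/-- The monoid ring `ℤ[Σ]`. -/
abbrev Coeffs (bar : S → S) : Type _ := MonoidAlgebra ℤ (Sig bar)

open Classical in
/-- The growth series `Θ(L) = ∑_{w ∈ L} φ(w) t^|w|`, with coefficients in `ℤ[Σ]`. -/
noncomputable def growthSeries [Finite S] (bar : S → S) (L : Language S) :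
    PowerSeries (Coeffs bar) :=
  PowerSeries.mk fun n =>
    ∑ w ∈ (List.finite_length_eq S n).toFinset with w ∈ L, MonoidAlgebra.of ℤ (Sig bar) (proj bar w)

/-- The composition `f(a) = ∑ᵢ fᵢ aⁱ` of formal power series over a ring that need not be
commutative, for `a` with zero constant coefficient. Since `aⁱ` is divisible by `tⁱ`, the terms
with `i > n` do not contribute to the coefficient of `tⁿ`. -/
noncomputable def comp {R : Type*} [Semiring R] (f a : PowerSeries R) : PowerSeries R :=
  PowerSeries.mk fun n => ∑ i ∈ Finset.range (n + 1), coeff i f * coeff n (a ^ i)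

/-- The inverse `1 / f` of a formal power series with constant coefficient `1`. -/
noncomputable def recip {R : Type*} [Ring R] (f : PowerSeries R) : PowerSeries R :=
  PowerSeries.invOfUnit f 1

/-- The identity `A(t) / (1 - t²) = B(t / (1 + (d - 1) t²)) / (1 + (d - 1) t²)` in `R⟦t⟧`. -/
def CogrowthIdentity {R : Type*} [Ring R] (d : ℕ) (A B : PowerSeries R) : Prop :=
  A * recip (1 - X ^ 2) =
    comp B (X * recip (1 + ((d : PowerSeries R) - 1) * X ^ 2)) *
      recip (1 + ((d : PowerSeries R) - 1) * X ^ 2)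

end WordGrowth

namespace WordGrowth

open PowerSeries Finset

/-! ### Power series over a noncommutative ring, and substitution of integral series. -/

section PowerSeries

variable {R : Type*} [Ring R]

/-! Write `A` for the sum of the generators in `ℤ[Σ]`. For the language of all words, `Θ = ∑ Aⁿ tⁿ`.
Multiplying reduced words by `A` either lengthens them or cancels a letter, which gives a linear
recurrence for the sums of reduced words (`genSum_mul_reducedSum_succ`), that is, `(1 - A t + (d -
1) t²) Θ = 1 - t²` for the reduced words. With `q = 1 + (d - 1) t²` the quadratic is `q (1 - A
t/q)`, so the identity follows. Membership in a saturated `M` depends only on the image in `Σ`, so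
restricting coefficients to the span of `φ(M)` turns the identity for all words into that for `M`;
this additive map respects the identity because every other series in it has integer coefficients.
For the equivalence, the right side determines the numerator on the left, and nested languages with
equal growth series coincide. -/

theorem recip_mul {f : PowerSeries R} (hf : constantCoeff f = 1) : recip f * f = 1 :=
  PowerSeries.invOfUnit_mul f 1 (by simpa using hf)

theorem mul_recip {f : PowerSeries R} (hf : constantCoeff f = 1) : f * recip f = 1 :=
  PowerSeries.mul_invOfUnit f 1 (by simpa using hf)

/-- The image of an integral power series in `R⟦t⟧`. -/
noncomputable abbrev intSeries (R : Type*) [Ring R] : PowerSeries ℤ →+* PowerSeries R :=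
  PowerSeries.map (Int.castRingHom R)

theorem recip_intSeries {f : PowerSeries ℤ} (hf : constantCoeff f = 1) :
    recip (intSeries R f) = intSeries R (recip f) := by
  have h : constantCoeff (intSeries R f) = 1 := by
    rw [← coeff_zero_eq_constantCoeff_apply] at hf ⊢
    simp [hf]
  refine left_inv_eq_right_inv (recip_mul h) ?_
  rw [← map_mul, mul_recip hf, map_one]

/-- Integers are central in `R`; this replaces commutativity, which `ℤ[Σ]` lacks in general. -/
theorem commute_intSeries (f : PowerSeries R) (g : PowerSeries ℤ) :
    Commute f (intSeries R g) := by
  ext n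
  rw [coeff_mul, coeff_mul, ← Finset.Nat.sum_antidiagonal_swap]
  refine Finset.sum_congr rfl fun p _ => ?_
  simpa using (Int.cast_commute (coeff p.1 g) (coeff p.2 f)).eq.symm

theorem coeff_pow_eq_zero_of_lt {a : PowerSeries R} (ha : constantCoeff a = 0) {i n : ℕ}
    (h : n < i) : coeff n (a ^ i) = 0 := by
  obtain ⟨b, rfl⟩ := X_dvd_iff.2 ha
  rw [← (commute_X b).eq, (commute_X b).mul_pow, (commute_X_pow _ i).eq]
  exact X_pow_dvd_iff.1 (dvd_mul_right _ _) n h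

theorem coeff_comp_of_le (f : PowerSeries R) {a : PowerSeries R} (ha : constantCoeff a = 0)
    {n N : ℕ} (h : n ≤ N) :
    coeff n (comp f a) = ∑ i ∈ range (N + 1), coeff i f * coeff n (a ^ i) := by
  rw [comp, coeff_mk]
  refine Finset.sum_subset (range_mono (by omega)) fun i _ hi => ?_
  rw [coeff_pow_eq_zero_of_lt ha (by simp at hi; omega), mul_zero]

/-- The substitution of `a` into the geometric series `∑ Aⁱ tⁱ` is a right inverse
of `1 - A a`. -/
theorem one_sub_mul_comp_geometric (A : R) {a : PowerSeries ℤ} (ha : constantCoeff a = 0) :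
    (1 - C A * intSeries R a) * comp (PowerSeries.mk fun n => A ^ n) (intSeries R a) = 1 := by
  have ha' : constantCoeff (intSeries R a) = 0 := by
    rw [← coeff_zero_eq_constantCoeff_apply] at ha ⊢
    simp [ha]
  set b := intSeries R a
  set G := comp (PowerSeries.mk fun n => A ^ n) b
  rw [sub_mul, one_mul, sub_eq_iff_eq_add]
  ext n
  have hG : coeff n (C A * b * G) = ∑ i ∈ range (n + 1), A ^ (i + 1) * coeff n (b ^ (i + 1)) := by
    rw [mul_assoc, coeff_C_mul, ← (commute_intSeries G a).eq, coeff_mul]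
    have : ∀ p ∈ antidiagonal n, coeff p.1 G * coeff p.2 b =
        ∑ i ∈ range (n + 1), A ^ i * (coeff p.1 (b ^ i) * coeff p.2 b) := by
      intro p hp
      rw [coeff_comp_of_le _ ha' (N := n) (by simp at hp; omega), Finset.sum_mul]
      simp [mul_assoc]
    rw [Finset.sum_congr rfl this, Finset.sum_comm, Finset.mul_sum]
    refine Finset.sum_congr rfl fun i _ => ?_
    rw [← Finset.mul_sum, ← mul_assoc, ← pow_succ', pow_succ b, coeff_mul]
  -- Truncating at `n + 1` adds only a zero term; splitting off `i = 0` then leaves exactly the sum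
  -- in `hG`.
  rw [map_add, hG, coeff_comp_of_le _ ha' (Nat.le_succ n), Finset.sum_range_succ']
  simp [add_comm]

/-- The additive map on power series that applies an additive map to all coefficients. -/
noncomputable def mapCoeff (P : R →+ R) (f : PowerSeries R) : PowerSeries R :=
  PowerSeries.mk fun n => P (coeff n f)

/-- An additive map is `ℤ`-linear, so it passes through integer coefficients. -/
theorem mapCoeff_mul_intSeries (P : R →+ R) (f : PowerSeries R) (g : PowerSeries ℤ) :
    mapCoeff P (f * intSeries R g) = mapCoeff P f * intSeries R g := by
  ext n
  simp only [mapCoeff, coeff_mul, coeff_mk, coeff_map, eq_intCast, map_sum]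
  exact Finset.sum_congr rfl fun p _ => by rw [← zsmul_eq_mul', map_zsmul, zsmul_eq_mul']

theorem mapCoeff_comp_intSeries (P : R →+ R) (f : PowerSeries R) (g : PowerSeries ℤ) :
    mapCoeff P (comp f (intSeries R g)) = comp (mapCoeff P f) (intSeries R g) := by
  ext n
  simp only [mapCoeff, comp, coeff_mk, ← map_pow, coeff_map, eq_intCast, map_sum]
  exact Finset.sum_congr rfl fun i _ => by rw [← zsmul_eq_mul', map_zsmul, zsmul_eq_mul']

/-- The series `1 + (d - 1) t²`. -/
noncomputable def quad (d : ℕ) : PowerSeries ℤ := 1 + ((d : PowerSeries ℤ) - 1) * X ^ 2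

theorem constantCoeff_quad (d : ℕ) : constantCoeff (quad d) = 1 := by
  simp [quad]

theorem intSeries_quad (d : ℕ) :
    intSeries R (quad d) = 1 + ((d : PowerSeries R) - 1) * X ^ 2 := by
  simp [quad]

theorem cogrowthIdentity_iff (d : ℕ) (A B : PowerSeries R) :
    CogrowthIdentity d A B ↔ A * intSeries R (recip (1 - X ^ 2)) =
      comp B (intSeries R (X * recip (quad d))) * intSeries R (recip (quad d)) := by
  have h : (1 - X ^ 2 : PowerSeries R) = intSeries R (1 - X ^ 2) := by simp
  rw [CogrowthIdentity, ← intSeries_quad, h, recip_intSeries (constantCoeff_quad d),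
    recip_intSeries (by simp), map_mul, PowerSeries.map_X]

theorem CogrowthIdentity.mapCoeff {d : ℕ} {A B : PowerSeries R} (h : CogrowthIdentity d A B)
    (P : R →+ R) : CogrowthIdentity d (mapCoeff P A) (mapCoeff P B) := by
  rw [cogrowthIdentity_iff] at h ⊢
  rw [← mapCoeff_mul_intSeries, h, mapCoeff_mul_intSeries, mapCoeff_comp_intSeries]

theorem CogrowthIdentity.left_unique {d : ℕ} {A A' B : PowerSeries R}
    (h : CogrowthIdentity d A B) (h' : CogrowthIdentity d A' B) : A = A' := by
  have hu : recip (1 - X ^ 2) * (1 - X ^ 2 : PowerSeries R) = 1 := recip_mul (by simp)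
  calc A = A * recip (1 - X ^ 2) * (1 - X ^ 2) := by rw [mul_assoc, hu, mul_one]
    _ = A' * recip (1 - X ^ 2) * (1 - X ^ 2) := by
      rw [CogrowthIdentity] at h h'
      rw [h, h']
    _ = A' := by rw [mul_assoc, hu, mul_one]

/-- The cogrowth identity between the geometric series `∑ Aⁿ tⁿ` and the solution of the linear
recurrence with characteristic polynomial `1 - A t + (d - 1) t²`. -/
theorem cogrowthIdentity_geometric (d : ℕ) (A : R) (r : PowerSeries R)
    (hr : (1 - C A * X + ((d : PowerSeries R) - 1) * X ^ 2) * r = 1 - X ^ 2) :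
    CogrowthIdentity d r (PowerSeries.mk fun n => A ^ n) := by
  rw [cogrowthIdentity_iff]
  set D : PowerSeries R := 1 - C A * X + ((d : PowerSeries R) - 1) * X ^ 2 with hD
  have hD0 : constantCoeff D = 1 := by simp [hD]
  have hQ : intSeries R (quad d) * intSeries R (recip (quad d)) = 1 := by
    rw [← map_mul, mul_recip (constantCoeff_quad d), map_one]
  have hDq : D = intSeries R (quad d) * (1 - C A * intSeries R (X * recip (quad d))) := by
    rw [mul_sub, mul_one, ← mul_assoc, ← (commute_intSeries (C A) (quad d)).eq, mul_assoc,
      ← map_mul, mul_left_comm, mul_recip (constantCoeff_quad d), mul_one, PowerSeries.map_X,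
      intSeries_quad, hD]
    abel
  refine (IsUnit.mul_right_inj (a := D)
    ⟨⟨D, recip D, mul_recip hD0, recip_mul hD0⟩, rfl⟩).1 ?_
  rw [← mul_assoc, hr, ← mul_assoc, hDq, mul_assoc (intSeries R (quad d)),
    one_sub_mul_comp_geometric A (by simp), mul_one, hQ]
  rw [show (1 - X ^ 2 : PowerSeries R) = intSeries R (1 - X ^ 2) by simp, ← map_mul,
    mul_recip (by simp), map_one]

end PowerSeries

/-! ### Reduced words and the monoid `Σ`. -/

section Words

variable {S : Type*}

/-- The word `w` contains no factor `s s̄`. -/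
def IsReduced (bar : S → S) (w : List S) : Prop :=
  ∀ s : S, ¬ [s, bar s] <:+: w

theorem isReduced_nil (bar : S → S) : IsReduced bar [] := by
  simp [IsReduced]

theorem isReduced_cons (bar : S → S) (x : S) (w : List S) :
    IsReduced bar (x :: w) ↔ w.head? ≠ some (bar x) ∧ IsReduced bar w := by
  cases w with
  | nil => simp [IsReduced, List.infix_cons_iff]
  | cons y w =>
    simp only [IsReduced, List.infix_cons_iff (a := x), List.cons_prefix_cons, List.nil_prefix,
      and_true, not_or, forall_and]
    refine and_congr_left' ?_
    simp only [List.head?_cons, ne_eq, Option.some.injEq, not_and]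
    exact ⟨fun h e => h x rfl e.symm, fun h s hs e => h (hs ▸ e.symm)⟩

theorem mem_desiccation (bar : S → S) (L : Language S) (w : List S) :
    w ∈ desiccation bar L ↔ w ∈ L ∧ IsReduced bar w := by
  constructor
  · intro h
    exact ⟨(isGreatest_desiccation bar L).1.2 h, (isGreatest_desiccation bar L).1.1 w h⟩
  · rintro ⟨hL, hw⟩
    have h : ({w} : Set (List S)) ≤ desiccation bar L := by
      refine (isGreatest_desiccation bar L).2 ⟨?_, ?_⟩
      · rintro v rfl
        exact hw
      · rintro v rfl
        exact hL
    exact h rfl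

theorem desiccation_mono (bar : S → S) {K L : Language S} (h : K ≤ L) :
    desiccation bar K ≤ desiccation bar L := fun w hw => by
  have hw' := (mem_desiccation bar K w).1 hw
  exact (mem_desiccation bar L w).2 ⟨h hw'.1, hw'.2⟩

theorem proj_nil (bar : S → S) : proj bar [] = 1 := map_one _

theorem proj_append (bar : S → S) (u v : List S) :
    proj bar (u ++ v) = proj bar u * proj bar v := map_mul _ _ _

theorem proj_cons (bar : S → S) (x : S) (w : List S) :
    proj bar (x :: w) = proj bar [x] * proj bar w := proj_append bar [x] w

theorem proj_cancel (bar : S → S) (s : S) (w : List S) :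
    proj bar (s :: bar s :: w) = proj bar w := by
  have h : proj bar [s, bar s] = 1 := PresentedMonoid.mk_eq_mk_of_rel (CancelRel.cancel s)
  rw [show s :: bar s :: w = [s, bar s] ++ w from rfl, proj_append, h, one_mul]

/-- Membership in a saturated language depends only on the image in `Σ`. -/
theorem IsSaturated.mem_iff_of_proj_eq {bar : S → S} {M : Language S} (hM : IsSaturated bar M)
    {v w : List S} (h : proj bar v = proj bar w) : v ∈ M ↔ w ∈ M := by
  -- The syntactic congruence of `M`: saturation says that it contains the defining relations of
  -- `Σ`, hence the congruence they generate.
  let c : Con (FreeMonoid S) :=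
    { r := fun a b => ∀ u v : List S, u ++ a.toList ++ v ∈ M ↔ u ++ b.toList ++ v ∈ M
      iseqv := ⟨fun _ _ _ => Iff.rfl, fun h u v => (h u v).symm,
        fun h h' u v => (h u v).trans (h' u v)⟩
      mul' := by
        intro a b a' b' h h' u v
        have h₁ := h u (a'.toList ++ v)
        have h₂ := h' (u ++ b.toList) v
        simp only [FreeMonoid.toList_mul, List.append_assoc] at h₁ h₂ ⊢
        exact h₁.trans h₂ }
  have hc : conGen (CancelRel bar) ≤ c := Con.conGen_le.2 fun a b hab => by
    cases hab with
    | cancel s =>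
      intro u v
      simpa using (hM u v s).symm
  have := hc (PresentedMonoid.mk_eq_mk_iff.1 h) [] []
  simpa using this

/-- The finite set of words of length `n`. -/
noncomputable abbrev words (S : Type*) [Finite S] (n : ℕ) : Finset (List S) :=
  (List.finite_length_eq S n).toFinset

theorem sum_words_zero [Finite S] {N : Type*} [AddCommMonoid N] (f : List S → N) :
    ∑ w ∈ words S 0, f w = f [] := by
  have : words S 0 = {[]} := by
    ext w
    simp
  rw [this, Finset.sum_singleton]

theorem sum_words_succ [Fintype S] {N : Type*} [AddCommMonoid N] (n : ℕ) (f : List S → N) :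
    ∑ w ∈ words S (n + 1), f w = ∑ s : S, ∑ w ∈ words S n, f (s :: w) := by
  rw [← Finset.sum_product']
  symm
  refine Finset.sum_bij (fun p _ => p.1 :: p.2) ?_ ?_ ?_ fun _ _ => rfl
  · rintro ⟨s, w⟩ h
    simpa using h
  · rintro ⟨s, w⟩ _ ⟨s', w'⟩ _ h
    simpa using h
  · rintro (_ | ⟨s, w⟩) h
    · simp at h
    · exact ⟨(s, w), by simpa using h, rfl⟩

end Words

/-! ### Growth series in `ℤ[Σ]`. -/

section Growth

variable {S : Type*} (bar : S → S)

/-- The image of a word in the monoid ring `ℤ[Σ]`. -/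
noncomputable def wordElem (w : List S) : Coeffs bar :=
  MonoidAlgebra.of ℤ (Sig bar) (proj bar w)

theorem wordElem_nil : wordElem bar [] = 1 := by
  rw [wordElem, proj_nil, map_one]

theorem wordElem_cons (x : S) (w : List S) :
    wordElem bar (x :: w) = wordElem bar [x] * wordElem bar w := by
  rw [wordElem, proj_cons, map_mul, wordElem, wordElem]

theorem wordElem_cancel (s : S) (w : List S) :
    wordElem bar (s :: bar s :: w) = wordElem bar w := by
  rw [wordElem, proj_cancel, wordElem]

variable [Fintype S]

/-- The sum of the generators in `ℤ[Σ]`. -/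
noncomputable def genSum : Coeffs bar := ∑ s : S, wordElem bar [s]

open Classical in
theorem coeff_growthSeries (L : Language S) (n : ℕ) :
    coeff n (growthSeries bar L) = ∑ w ∈ words S n, if w ∈ L then wordElem bar w else 0 := by
  rw [growthSeries, coeff_mk, Finset.sum_filter]
  rfl

theorem growthSeries_top :
    growthSeries bar (⊤ : Language S) = PowerSeries.mk fun n => genSum bar ^ n := by
  ext1 n
  have hmem : ∀ w : List S, w ∈ (⊤ : Language S) := fun w => Set.mem_univ w
  simp only [coeff_growthSeries, coeff_mk, hmem, if_true]
  induction n with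
  | zero => rw [sum_words_zero, wordElem_nil, pow_zero]
  | succ n ih =>
    rw [sum_words_succ, pow_succ', ← ih, genSum, Finset.sum_mul]
    refine Finset.sum_congr rfl fun s _ => ?_
    rw [Finset.mul_sum]
    exact Finset.sum_congr rfl fun w _ => wordElem_cons bar s w

open Classical in
/-- The sum of the reduced words of length `n` in `ℤ[Σ]`. -/
noncomputable def reducedSum (n : ℕ) : Coeffs bar :=
  ∑ w ∈ words S n, if IsReduced bar w then wordElem bar w else 0

theorem reducedSum_zero : reducedSum bar 0 = 1 := by
  rw [reducedSum, sum_words_zero, if_pos (isReduced_nil bar), wordElem_nil]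

theorem reducedSum_one : reducedSum bar 1 = genSum bar := by
  rw [reducedSum, sum_words_succ, genSum]
  refine Finset.sum_congr rfl fun s _ => ?_
  rw [sum_words_zero, if_pos]
  simp [isReduced_cons, isReduced_nil]

variable {bar}

open Classical in
-- Prepending `s` to a nonempty reduced word keeps it reduced unless its head is `bar s`. In that
-- case `s` and `bar s` cancel and leave a reduced `w`, which arises once for each `s` with `bar s
-- :: w` reduced; by involutivity this means that `s` is not the head of `w`.
theorem genSum_mul_reducedSum_succ (hbar : Function.Involutive bar) (n : ℕ) :
    genSum bar * reducedSum bar (n + 1) = reducedSum bar (n + 2) +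
      ∑ w ∈ words S n, #{s : S | w.head? ≠ some s} •
        if IsReduced bar w then wordElem bar w else 0 := by
  have hcount : ∀ w : List S, (#{s : S | w.head? ≠ some s} •
      if IsReduced bar w then wordElem bar w else 0) =
      ∑ s : S, if IsReduced bar (bar s :: w) then wordElem bar (s :: bar s :: w) else 0 := by
    intro w
    rw [← Finset.sum_const, Finset.sum_filter]
    refine Finset.sum_congr rfl fun s _ => ?_
    rw [isReduced_cons, hbar s, wordElem_cancel]
    split_ifs <;> tauto
  simp only [hcount]
  rw [Finset.sum_comm, genSum, Finset.sum_mul, reducedSum, reducedSum, sum_words_succ (n + 1),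
    ← Finset.sum_add_distrib]
  refine Finset.sum_congr rfl fun s _ => ?_
  rw [sum_words_succ, sum_words_succ, Finset.mul_sum,
    ← Finset.sum_erase_add _ _ (Finset.mem_univ (bar s)),
    ← Finset.sum_erase_add (a := bar s) univ (fun x => ∑ w ∈ words S n,
      if IsReduced bar (s :: x :: w) then wordElem bar (s :: x :: w) else 0) (Finset.mem_univ _)]
  have hzero : ∀ w : List S, ¬ IsReduced bar (s :: bar s :: w) := fun w => by
    simp [isReduced_cons bar s]
  simp only [hzero, if_false, Finset.sum_const_zero, add_zero]
  congr 1
  · refine Finset.sum_congr rfl fun x hx => ?_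
    rw [Finset.mul_sum]
    refine Finset.sum_congr rfl fun w _ => ?_
    have hx' : x ≠ bar s := (Finset.mem_erase.1 hx).1
    rw [isReduced_cons bar s, List.head?_cons, and_iff_right (by simpa using hx'), mul_ite,
      mul_zero, ← wordElem_cons]
  · rw [Finset.mul_sum]
    refine Finset.sum_congr rfl fun w _ => ?_
    rw [mul_ite, mul_zero, ← wordElem_cons]

open Classical in
theorem reducedSum_two (hbar : Function.Involutive bar) :
    reducedSum bar 2 = genSum bar * reducedSum bar 1 - (Fintype.card S : Coeffs bar) := by
  rw [genSum_mul_reducedSum_succ hbar 0, sum_words_zero]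
  simp [isReduced_nil, wordElem_nil]

open Classical in
theorem reducedSum_add_three (hbar : Function.Involutive bar) (n : ℕ) :
    reducedSum bar (n + 3) = genSum bar * reducedSum bar (n + 2) -
      ((Fintype.card S : Coeffs bar) - 1) * reducedSum bar (n + 1) := by
  rw [genSum_mul_reducedSum_succ hbar (n + 1), eq_sub_iff_add_eq, add_right_inj, reducedSum,
    Finset.mul_sum]
  refine Finset.sum_congr rfl fun w hw => ?_
  obtain _ | ⟨x, w⟩ := w
  · simp at hw
  -- The letter `x` gives `1 ≤ d`, so the natural subtraction `d - 1` casts correctly.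
  have : Nonempty S := ⟨x⟩
  have hcard : #{s : S | (x :: w).head? ≠ some s} = Fintype.card S - 1 := by
    have : ({s : S | (x :: w).head? ≠ some s} : Finset S) = univ.erase x := by
      ext s
      simp [eq_comm]
    rw [this, Finset.card_erase_of_mem (Finset.mem_univ x), Finset.card_univ]
  rw [hcard, nsmul_eq_mul, Nat.cast_sub Fintype.card_pos, Nat.cast_one]

theorem growthSeries_desiccation_top :
    growthSeries bar (desiccation bar (⊤ : Language S)) = PowerSeries.mk (reducedSum bar) := by
  classical
  ext1 n
  rw [coeff_growthSeries, coeff_mk, reducedSum]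
  refine Finset.sum_congr rfl fun w _ => ?_
  have : w ∈ desiccation bar (⊤ : Language S) ↔ IsReduced bar w :=
    (mem_desiccation bar ⊤ w).trans (and_iff_right (Set.mem_univ w))
  simp only [this]

theorem quadratic_mul_reducedSum (hbar : Function.Involutive bar) :
    (1 - C (genSum bar) * X + ((Fintype.card S : PowerSeries (Coeffs bar)) - 1) * X ^ 2) *
      PowerSeries.mk (reducedSum bar) = 1 - X ^ 2 := by
  have hd : (Fintype.card S : PowerSeries (Coeffs bar)) - 1 =
      C ((Fintype.card S : Coeffs bar) - 1) := by simp
  rw [hd, add_mul, sub_mul, one_mul, mul_assoc, mul_assoc]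
  ext1 n
  rw [map_add, map_sub, coeff_C_mul, coeff_C_mul, map_sub]
  match n with
  | 0 => simp [reducedSum_zero, coeff_X_pow]
  | 1 =>
    simp [coeff_succ_X_mul, reducedSum_zero, reducedSum_one, coeff_X_pow_mul', coeff_one,
      coeff_X_pow]
  -- The empty word has no head to exclude, so `d` letters count instead of `d - 1`; the excess is
  -- the `-X ^ 2` on the right.
  | 2 =>
    simp [coeff_succ_X_mul, reducedSum_zero, reducedSum_two hbar, coeff_X_pow_mul', coeff_one,
      coeff_X_pow]
    abel
  | n + 3 =>
    simp [coeff_succ_X_mul, coeff_X_pow_mul', coeff_one, coeff_X_pow, reducedSum_add_three hbar]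

theorem cogrowthIdentity_top (hbar : Function.Involutive bar) :
    CogrowthIdentity (Fintype.card S) (growthSeries bar (desiccation bar (⊤ : Language S)))
      (growthSeries bar (⊤ : Language S)) := by
  rw [growthSeries_top, growthSeries_desiccation_top]
  exact cogrowthIdentity_geometric _ _ _ (quadratic_mul_reducedSum hbar)

open Classical in
/-- The additive projection of a monoid ring onto the span of the elements satisfying `p`. -/
noncomputable def restrict {G : Type*} (p : G → Prop) :
    MonoidAlgebra ℤ G →+ MonoidAlgebra ℤ G :=
  (MonoidAlgebra.coeffAddEquiv (R := ℤ) (M := G)).symm.toAddMonoidHom.comp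
    ((Finsupp.filterAddHom p).comp
      (MonoidAlgebra.coeffAddEquiv (R := ℤ) (M := G)).toAddMonoidHom)

open Classical in
theorem restrict_of {G : Type*} [Monoid G] (p : G → Prop) (g : G) :
    restrict p (MonoidAlgebra.of ℤ G g) = if p g then MonoidAlgebra.of ℤ G g else 0 := by
  have h : restrict p (MonoidAlgebra.of ℤ G g) =
      MonoidAlgebra.ofCoeff ((Finsupp.single g (1 : ℤ)).filter p) := by
    rfl
  rw [h]
  split_ifs with hp
  · rw [Finsupp.filter_single_of_pos _ hp]
    rfl
  · rw [Finsupp.filter_single_of_neg _ hp]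
    rfl

/-- Restricting the growth series of `K` to the image in `Σ` of a saturated language. -/
theorem mapCoeff_growthSeries {M : Language S} (hM : IsSaturated bar M) (K : Language S) :
    mapCoeff (restrict fun g => ∃ w ∈ M, proj bar w = g) (growthSeries bar K) =
      growthSeries bar (M ⊓ K) := by
  classical
  ext1 n
  rw [mapCoeff, coeff_mk, coeff_growthSeries, coeff_growthSeries, map_sum]
  refine Finset.sum_congr rfl fun w _ => ?_
  have hmem : w ∈ M ⊓ K ↔ w ∈ M ∧ w ∈ K := Iff.rfl
  have hex : (∃ v ∈ M, proj bar v = proj bar w) ↔ w ∈ M :=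
    ⟨fun ⟨_, hv, h⟩ => (hM.mem_iff_of_proj_eq h).1 hv, fun h => ⟨w, h, rfl⟩⟩
  by_cases hK : w ∈ K
  · simp only [hmem, hK, and_true, if_true, wordElem, restrict_of, hex]
  · simp [hmem, hK]

theorem IsSaturated.cogrowthIdentity (hbar : Function.Involutive bar) {M : Language S}
    (hM : IsSaturated bar M) :
    CogrowthIdentity (Fintype.card S) (growthSeries bar (desiccation bar M))
      (growthSeries bar M) := by
  have h := (cogrowthIdentity_top hbar).mapCoeff (restrict fun g => ∃ w ∈ M, proj bar w = g)
  rw [mapCoeff_growthSeries hM, mapCoeff_growthSeries hM, inf_top_eq] at h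
  have hd : M ⊓ desiccation bar ⊤ = desiccation bar M := by
    ext w
    rw [mem_desiccation]
    exact and_congr_right fun _ =>
      (mem_desiccation bar ⊤ w).trans (and_iff_right (Set.mem_univ w))
  rwa [hd] at h

open Classical in
/-- The augmentation of the `n`-th coefficient counts the words of length `n`. -/
theorem augmentation_coeff_growthSeries (L : Language S) (n : ℕ) :
    MonoidAlgebra.lift ℤ ℤ (Sig bar) 1 (coeff n (growthSeries bar L)) =
      #{w ∈ words S n | w ∈ L} := by
  rw [coeff_growthSeries, ← Finset.sum_filter, map_sum]
  simp [wordElem]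

/-- Augmentation recovers the number of words of each length, which is finite, so no normal form in
`Σ` is needed. -/
theorem eq_of_le_of_growthSeries_eq {K L : Language S} (hKL : K ≤ L)
    (h : growthSeries bar K = growthSeries bar L) : K = L := by
  classical
  refine le_antisymm hKL fun w hw => ?_
  have hcard : #{v ∈ words S w.length | v ∈ K} = #{v ∈ words S w.length | v ∈ L} := by
    have := augmentation_coeff_growthSeries (bar := bar) K w.length
    rw [h, augmentation_coeff_growthSeries] at this
    exact_mod_cast this.symm
  have hsub : {v ∈ words S w.length | v ∈ K} ⊆ {v ∈ words S w.length | v ∈ L} :=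
    Finset.monotone_filter_right _ fun v _ hv => hKL hv
  have hwL : w ∈ {v ∈ words S w.length | v ∈ L} :=
    Finset.mem_filter.2 ⟨by simp, hw⟩
  rw [← Finset.eq_of_subset_of_card_le hsub hcard.ge] at hwL
  exact (Finset.mem_filter.1 hwL).2

end Growth

end WordGrowth

theorem mainTheorem7 {S : Type*} [Fintype S] (bar : S → S) (hbar : Function.Involutive bar)
    (L : Language S) :
    WordGrowth.CogrowthIdentity (Fintype.card S)
      (WordGrowth.growthSeries bar (WordGrowth.desiccation bar (WordGrowth.saturation bar L)))
      (WordGrowth.growthSeries bar (WordGrowth.saturation bar L)) ∧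
    (WordGrowth.CogrowthIdentity (Fintype.card S)
      (WordGrowth.growthSeries bar (WordGrowth.desiccation bar L))
      (WordGrowth.growthSeries bar (WordGrowth.saturation bar L)) ↔
      WordGrowth.desiccation bar L =
        WordGrowth.desiccation bar (WordGrowth.saturation bar L)) := by
  have hsat := (WordGrowth.isLeast_saturation bar L).1
  have h := hsat.1.cogrowthIdentity hbar
  refine ⟨h, fun h' => ?_, fun h' => h'.symm ▸ h⟩
  exact WordGrowth.eq_of_le_of_growthSeries_eq (WordGrowth.desiccation_mono bar hsat.2)
    (h'.left_unique h)
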